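/- Let $d\ge 1$, let $A\in\mathbb R^{d\times d}$ be regular, and let $\Lambda=A\mathbb Z^d$, $V_\Lambda=|\det A|$, $\Lambda^*=A^{-T}\mathbb Z^d$ (so $V_{\Lambda^*}=1/|\det A|$). For $x,y\in\mathbb R^d$ let $\nu\mapsto Z_{\Lambda,\nu}(x,y)$ denote the meromorphic continuation to $\mathbb C$ of the absolutely convergent sum $$\sum_{z\in\Lambda,\ z\ne x}\frac{e^{-2\pi i\,y\cdot z}}{|x-z|^{\nu}},\qquad \operatorname{Re}\nu>d .$$ This continuation exists, and it is holomorphic on $\mathbb C$ if $y\notin\Lambda^*$ and on $\mathbb C\setminus\{d\}$ if $y\in\Lambda^*$; correspondingly, $\nu\mapsto Z_{\Lambda^*,d-\nu}(y,-x)$ is holomorphic on $\mathbb C$ if $x\notin\Lambda$ and on $\mathbb C\setminus\{0\}$ if $x\in\Lambda$. Put $$\Phi(\Lambda,\nu,x,y)=\frac{(V_\Lambda^{2/d}/\pi)^{\nu/2}}{\Gamma\big((d-\nu)/2\big)}\,e^{\pi i\,x\cdot y}\,Z_{\Lambda,\nu}(x,y),$$ where $1/\Gamma$ is the entire reciprocal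 Gamma function. Then $\Phi$ is invariant under $(\Lambda,\nu,x,y)\to(\Lambda^*,d-\nu,y,-x)$: $$\Phi(\Lambda,\nu,x,y)=\Phi(\Lambda^*,d-\nu,y,-x)$$ for all $\nu\in\mathbb C$ except $\nu=d$ when $y\in\Lambda^*$ and $\nu=0$ when $x\in\Lambda$. Moreover both sides have only removable singularities at these exceptional points: there is one entire function $F$ with $\Phi(\Lambda,\nu,x,y)=F(\nu)$ for all $\nu$ (except $\nu=d$ if $y\in\Lambda^*$) and $\Phi(\Lambda^*,d-\nu,y,-x)=F(\nu)$ for all $\nu$ (except $\nu=0$ if $x\in\Lambda$). -/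

import Mathlib

namespace EpsteinZeta

/-- The set of points `A ℤ^d` in Euclidean space `ℝ^d`. -/
def lattice {d : ℕ} (A : Matrix (Fin d) (Fin d) ℝ) : Set (EuclideanSpace ℝ (Fin d)) :=
  Set.range fun n : Fin d → ℤ => WithLp.toLp 2 (A.mulVec fun i => (n i : ℝ))

/-- The generator `A⁻ᵀ` of the reciprocal lattice of `A ℤ^d`. -/
noncomputable def reciprocal {d : ℕ} (A : Matrix (Fin d) (Fin d) ℝ) :
    Matrix (Fin d) (Fin d) ℝ :=
  A⁻¹.transpose

/-- The volume `|det A|` of the elementary cell of `A ℤ^d`. -/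
def cellVolume {d : ℕ} (A : Matrix (Fin d) (Fin d) ℝ) : ℝ :=
  |A.det|

/-- The summand `exp (-2πi y·z) / |x - z|^ν` of the Epstein lattice sum. -/
noncomputable def latticeTerm {d : ℕ} (ν : ℂ) (x y z : EuclideanSpace ℝ (Fin d)) : ℂ :=
  Complex.exp (-2 * (Real.pi : ℂ) * Complex.I * ((inner ℝ y z : ℝ) : ℂ)) /
    ((‖x - z‖ : ℝ) : ℂ) ^ ν

/-- `f` is a meromorphic continuation to `ℂ` of the lattice sum over `z ∈ L`, `z ≠ x`, which is
required to converge unconditionally (equivalently absolutely) for `Re ν > d`. The normal form of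
`f` means that `f` is analytic wherever its singularity is removable; at a pole its value is `0` by
convention. -/
def IsContinuation {d : ℕ} (L : Set (EuclideanSpace ℝ (Fin d)))
    (x y : EuclideanSpace ℝ (Fin d)) (f : ℂ → ℂ) : Prop :=
  MeromorphicNFOn f Set.univ ∧
    ∀ ν : ℂ, (d : ℝ) < ν.re →
      HasSum (fun z : {z : EuclideanSpace ℝ (Fin d) // z ∈ L ∧ z ≠ x} => latticeTerm ν x y z)
        (f ν)

/-- The continuation is unique, so that choosing one below is harmless. -/
theorem IsContinuation.unique {d : ℕ} {L : Set (EuclideanSpace ℝ (Fin d))}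
    {x y : EuclideanSpace ℝ (Fin d)} {f g : ℂ → ℂ}
    (hf : IsContinuation L x y f) (hg : IsContinuation L x y g) : f = g := by
  have hm : MeromorphicOn (f - g) Set.univ := hf.1.meromorphicOn.sub hg.1.meromorphicOn
  have hop : IsOpen {ν : ℂ | (d : ℝ) < ν.re} := isOpen_lt continuous_const Complex.continuous_re
  have hmem : ((d : ℂ) + 1) ∈ {ν : ℂ | (d : ℝ) < ν.re} := by simp
  have htop : meromorphicOrderAt (f - g) ((d : ℂ) + 1) = ⊤ := by
    rw [meromorphicOrderAt_eq_top_iff]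
    apply Filter.Eventually.filter_mono nhdsWithin_le_nhds
    filter_upwards [hop.mem_nhds hmem] with ν hν
    simp [(hf.2 ν hν).unique (hg.2 ν hν)]
  funext s
  have hs : meromorphicOrderAt (f - g) s = ⊤ := by
    by_contra h
    exact hm.meromorphicOrderAt_ne_top_of_isPreconnected isPreconnected_univ
      (Set.mem_univ s) (Set.mem_univ _) h htop
  rw [meromorphicOrderAt_eq_top_iff] at hs
  have he : f =ᶠ[nhdsWithin s {s}ᶜ] g := by
    filter_upwards [hs] with w hw
    exact sub_eq_zero.1 hw
  exact (((hf.1 (Set.mem_univ s)).eventuallyEq_nhdsNE_iff_eventuallyEq_nhds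
    (hg.1 (Set.mem_univ s))).1 he).eq_of_nhds

open Classical in
/-- The Epstein zeta function `Z_{L,ν}(x,y)`: the meromorphic continuation in `ν` of the lattice
sum. -/
noncomputable def epsteinZeta {d : ℕ} (L : Set (EuclideanSpace ℝ (Fin d))) (ν : ℂ)
    (x y : EuclideanSpace ℝ (Fin d)) : ℂ :=
  if h : ∃ f : ℂ → ℂ, IsContinuation L x y f then h.choose ν else 0

/-- The product `(V^{2/d}/π)^{ν/2} Γ((d-ν)/2)⁻¹ e^{πi x·y} Z_{Λ,ν}(x,y)` for `Λ = A ℤ^d`. Since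
`Complex.Gamma` is `0` at its poles, `(Complex.Gamma s)⁻¹` is the entire function `1/Γ`. -/
noncomputable def completedProduct {d : ℕ} (A : Matrix (Fin d) (Fin d) ℝ) (ν : ℂ)
    (x y : EuclideanSpace ℝ (Fin d)) : ℂ :=
  ((cellVolume A ^ (2 / (d : ℝ)) / Real.pi : ℝ) : ℂ) ^ (ν / 2) *
    (Complex.Gamma (((d : ℂ) - ν) / 2))⁻¹ *
    Complex.exp ((Real.pi : ℂ) * Complex.I * ((inner ℝ x y : ℝ) : ℂ)) *
    epsteinZeta (lattice A) ν x y

end EpsteinZeta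

/-! This is Riemann's theta function argument. Let `theta A x y t` be the sum over `n` of `exp (-2πi
y·An) exp (-π |x - An|² t)`. Poisson summation gives `θ_A(x, y; 1/t) = t^(d/2) V⁻¹ e^(-2πi x·y)
θ_{A⁻ᵀ}(y, -x; t)` (`theta_one_div`). As `t → ∞`, theta tends rapidly to a constant, which vanishes
unless `x ∈ Λ`; the constant on the dual side vanishes unless `y ∈ Λ*`. The two functions therefore
form a `WeakFEPair`, with `k = d/2`, whose Mellin transform continues to `Λ(s) = Λ₀(s) - f₀/s - ε
g₀/(k - s)` with `Λ₀` entire.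

For `Re ν > d`, integrating termwise gives `Λ(ν/2) = π^(-ν/2) Γ(ν/2) Z_ν(x, y)`. Dividing by `Γ(s)`
removes the pole at `0`, so `Z` has at most the pole `ν = d`, and only if `y ∈ Λ*`. Dividing also by
`Γ(k - s)` removes this pole and restores the symmetry `s ↔ k - s`. The result,
`doubleGammaQuotient`, is entire, and `Φ` is this function times elementary factors that absorb `V⁻¹
e^(-2πi x·y)`. -/

open MeasureTheory Set Filter Topology Asymptotics

namespace EpsteinZeta

/-! ### Poisson summation over `ℤ^ι` -/

section Poisson

variable {ι : Type*}

/-- The half-open unit cube with lower corner `n`. -/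
def unitCube (n : ι → ℤ) : Set (ι → ℝ) := {v | ∀ i, v i ∈ Ioc (n i : ℝ) (n i + 1)}

/-- A vector of integers, as a vector of real numbers. -/
def castVec (n : ι → ℤ) : ι → ℝ := fun i => (n i : ℝ)

lemma measurableSet_unitCube [Fintype ι] (n : ι → ℤ) : MeasurableSet (unitCube n) :=
  MeasurableSet.univ_pi' fun _ => measurableSet_Ioc

lemma iUnion_unitCube : ⋃ n : ι → ℤ, unitCube n = univ := by
  refine eq_univ_of_forall fun v => mem_iUnion.2 ⟨fun i => ⌈v i⌉ - 1, fun i => ⟨?_, ?_⟩⟩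
  · push_cast
    linarith [Int.ceil_lt_add_one (v i)]
  · push_cast
    linarith [Int.le_ceil (v i)]

lemma pairwise_disjoint_unitCube : Pairwise (Function.onFun Disjoint (unitCube (ι := ι))) := by
  intro m n hmn
  refine disjoint_left.2 fun v hm hn => hmn (funext fun i => ?_)
  have h1 := hm i
  have h2 := hn i
  have h3 : (m i : ℝ) < n i + 1 := h1.1.trans_le h2.2
  have h4 : (n i : ℝ) < m i + 1 := h2.1.trans_le h1.2
  have h5 : m i < n i + 1 := by exact_mod_cast h3
  have h6 : n i < m i + 1 := by exact_mod_cast h4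
  lia

lemma castVec_add_mem_unitCube {n : ι → ℤ} {v : ι → ℝ} :
    v + castVec n ∈ unitCube n ↔ v ∈ unitCube (0 : ι → ℤ) := by
  refine forall_congr' fun i => ?_
  simp only [castVec, Pi.add_apply, mem_Ioc, Pi.zero_apply, Int.cast_zero]
  constructor <;> rintro ⟨h1, h2⟩ <;> constructor <;> linarith

lemma setIntegral_unitCube [Fintype ι] (g : (ι → ℝ) → ℂ) (n : ι → ℤ) :
    ∫ v in unitCube n, g v = ∫ v in unitCube (0 : ι → ℤ), g (v + castVec n) := by
  have h := (measurePreserving_add_right (volume : Measure (ι → ℝ)) (castVec n)).setIntegral_preimage_emb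
    (measurableEmbedding_addRight _) g (unitCube n)
  rw [← h]
  congr 2
  ext v
  exact castVec_add_mem_unitCube

lemma norm_le_of_mem_unitCube [Fintype ι] {v : ι → ℝ} (hv : v ∈ unitCube (0 : ι → ℤ)) :
    ‖v‖ ≤ 1 := by
  refine (pi_norm_le_iff_of_nonneg zero_le_one).2 fun i => ?_
  have h := hv i
  simp only [Pi.zero_apply, Int.cast_zero, zero_add, mem_Ioc] at h
  rw [Real.norm_eq_abs, abs_le]
  exact ⟨by linarith [h.1], h.2⟩

lemma volume_unitCube_zero [Fintype ι] : volume (unitCube (0 : ι → ℤ)) = 1 := by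
  have : unitCube (0 : ι → ℤ) = Set.pi univ fun _ => Ioc (0 : ℝ) 1 := by
    ext v; simp [unitCube]
  rw [this, Real.volume_pi_Ioc]
  simp

/-- The character `v ↦ exp (-2πi k·v)` of `ℝ^ι`. -/
noncomputable def char [Fintype ι] (k : ι → ℤ) (v : ι → ℝ) : ℂ :=
  Complex.exp (-2 * Real.pi * Complex.I * (∑ i, (k i : ℝ) * v i : ℝ))

lemma norm_char [Fintype ι] (k : ι → ℤ) (v : ι → ℝ) : ‖char k v‖ = 1 := by
  rw [char, Complex.norm_exp]
  simp

lemma continuous_char [Fintype ι] (k : ι → ℤ) : Continuous (char k) := by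
  unfold char
  fun_prop

lemma char_add_castVec [Fintype ι] (k n : ι → ℤ) (v : ι → ℝ) :
    char k (v + castVec n) = char k v := by
  simp only [char, castVec, Pi.add_apply, mul_add, Finset.sum_add_distrib]
  rw [Complex.exp_eq_exp_iff_exists_int]
  refine ⟨-∑ i, k i * n i, ?_⟩
  push_cast
  ring

lemma mFourier_neg_coe [Fintype ι] (k : ι → ℤ) (v : ι → ℝ) :
    UnitAddTorus.mFourier (-k) (fun i => (v i : UnitAddCircle)) = char k v := by
  simp only [UnitAddTorus.mFourier, ContinuousMap.coe_mk, fourier_coe_apply, ← Complex.exp_sum,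
    char]
  congr 1
  push_cast
  rw [Finset.mul_sum]
  refine Finset.sum_congr rfl fun i _ => ?_
  simp only [Pi.neg_apply, Int.cast_neg]
  ring

lemma isOpenQuotientMap_torus :
    IsOpenQuotientMap (fun (v : ι → ℝ) (i : ι) => (v i : UnitAddCircle)) :=
  IsOpenQuotientMap.piMap fun _ => QuotientAddGroup.isOpenQuotientMap_mk

/-- **Poisson summation** over `ℤ^ι`, for a continuous integrable function whose translates by
integer vectors are summable locally uniformly. -/
theorem hasSum_integral_char_mul [Fintype ι] {f : (ι → ℝ) → ℂ} (hf : Continuous f)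
    (hfi : Integrable f)
    (hb : ∀ R : ℝ, ∃ u : (ι → ℤ) → ℝ, Summable u ∧
      ∀ v, ‖v‖ ≤ R → ∀ n, ‖f (v + castVec n)‖ ≤ u n)
    (hs : Summable fun k : ι → ℤ => ∫ v, char k v * f v) :
    HasSum (fun k : ι → ℤ => ∫ v, char k v * f v) (∑' n : ι → ℤ, f (castVec n)) := by
  -- The periodization of `f` descends to a continuous function `G` on the torus. Its Fourier
  -- series, evaluated at `0`, is the claim.
  set F : (ι → ℝ) → ℂ := fun v => ∑' n : ι → ℤ, f (v + castVec n) with hF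
  have hFc : Continuous F := by
    rw [continuous_iff_continuousAt]
    intro v
    obtain ⟨u, hu, hu'⟩ := hb (‖v‖ + 1)
    have : ContinuousOn F (Metric.closedBall 0 (‖v‖ + 1)) :=
      continuousOn_tsum (fun n => (hf.comp (continuous_id.add continuous_const)).continuousOn) hu
        fun n w hw => hu' w (by simpa using hw) n
    refine this.continuousAt (Filter.mem_of_superset (Metric.ball_mem_nhds v one_pos) ?_)
    intro w hw
    rw [Metric.mem_ball, dist_eq_norm] at hw
    rw [mem_closedBall_zero_iff]
    have := norm_sub_norm_le w v
    linarith
  have hFper : ∀ v w : ι → ℝ, (fun i => (v i : UnitAddCircle)) = (fun i => (w i : UnitAddCircle)) →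
      F v = F w := by
    intro v w hvw
    have h1 : ∀ i, ∃ m : ℤ, v i = w i + m := by
      intro i
      have h : ((v i - w i : ℝ) : UnitAddCircle) = 0 := by
        rw [AddCircle.coe_sub, sub_eq_zero]
        exact congrFun hvw i
      obtain ⟨m, hm⟩ := (AddCircle.coe_eq_zero_iff 1).1 h
      exact ⟨m, by rw [zsmul_one] at hm; linarith⟩
    choose m hm using h1
    have h2 : v = w + castVec m := funext hm
    rw [hF]
    simp only
    rw [← (Equiv.addLeft m).tsum_eq (fun n => f (w + castVec n))]
    refine tsum_congr fun n => ?_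
    rw [h2]
    congr 1
    ext i
    simp [castVec, add_assoc]
  -- Any section of the quotient map will do, since `F` is constant on its fibres; continuity of `G`
  -- comes from the quotient topology, not from `s`.
  let s := Function.surjInv (isOpenQuotientMap_torus (ι := ι)).surjective
  have hs' : ∀ v : ι → ℝ, F (s fun i => (v i : UnitAddCircle)) = F v := fun v =>
    hFper _ _ (Function.surjInv_eq (isOpenQuotientMap_torus (ι := ι)).surjective _)
  let G : C(UnitAddTorus ι, ℂ) := ⟨fun x => F (s x), by
    refine (isOpenQuotientMap_torus (ι := ι)).isQuotientMap.continuous_iff.2 ?_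
    exact hFc.congr fun v => (hs' v).symm⟩
  -- Unfolding: as `char k` is periodic, the translates of the unit cube reassemble the integral
  -- over the whole space.
  have hcoeff : ∀ k : ι → ℤ, UnitAddTorus.mFourierCoeff G k = ∫ v, char k v * f v := by
    intro k
    have h1 : UnitAddTorus.mFourierCoeff G k = ∫ v in unitCube (0 : ι → ℤ), char k v * F v := by
      rw [UnitAddTorus.mFourierCoeff_eq_integral G k 0]
      have : {x : ι → ℝ | ∀ i, x i ∈ Ioc ((0 : ι → ℝ) i) ((0 : ι → ℝ) i + 1)} =
          unitCube (0 : ι → ℤ) := by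
        simp [unitCube]
      rw [this]
      refine integral_congr_ae (Filter.Eventually.of_forall fun v => ?_)
      simp only [mFourier_neg_coe, smul_eq_mul]
      congr 1
      exact hs' v
    have h2 : HasSum (fun n => ∫ v in unitCube (0 : ι → ℤ), char k v * f (v + castVec n))
        (∫ v in unitCube (0 : ι → ℤ), char k v * F v) := by
      obtain ⟨u, hu, hu'⟩ := hb 1
      have hbd : ∀ n, ∀ v ∈ unitCube (0 : ι → ℤ), ‖char k v * f (v + castVec n)‖ ≤ u n := by
        intro n v hv
        rw [norm_mul, norm_char, one_mul]
        exact hu' v (norm_le_of_mem_unitCube hv) n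
      refine hasSum_integral_of_dominated_convergence (fun n _ => u n) (fun n => ?_) (fun n => ?_)
        (Filter.Eventually.of_forall fun _ => hu) ?_ ?_
      · exact ((continuous_char k).mul
          (hf.comp (continuous_id.add continuous_const))).aestronglyMeasurable
      · exact (ae_restrict_iff' (measurableSet_unitCube _)).2
          (Filter.Eventually.of_forall fun v hv => hbd n v hv)
      · exact integrableOn_const (by rw [volume_unitCube_zero]; simp)
      · refine (ae_restrict_iff' (measurableSet_unitCube _)).2
          (Filter.Eventually.of_forall fun v hv => ?_)
        refine HasSum.mul_left _ (Summable.hasSum ?_)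
        exact Summable.of_norm_bounded hu fun n => hu' v (norm_le_of_mem_unitCube hv) n
    have h3 : HasSum (fun n => ∫ v in unitCube n, char k v * f v) (∫ v, char k v * f v) := by
      have hi : Integrable fun v => char k v * f v :=
        hfi.bdd_mul (c := 1) (continuous_char k).aestronglyMeasurable
          (Filter.Eventually.of_forall fun v => (norm_char k v).le)
      have := hasSum_integral_iUnion (f := fun v => char k v * f v) (μ := volume)
        (measurableSet_unitCube (ι := ι)) pairwise_disjoint_unitCube hi.integrableOn
      rwa [iUnion_unitCube, Measure.restrict_univ] at this
    have h4 : ∀ n, ∫ v in unitCube n, char k v * f v =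
        ∫ v in unitCube (0 : ι → ℤ), char k v * f (v + castVec n) := fun n => by
      rw [setIntegral_unitCube]
      simp only [char_add_castVec]
    rw [funext h4] at h3
    rw [h1]
    exact h2.unique h3
  have hsum : Summable (UnitAddTorus.mFourierCoeff G) := by
    rw [funext hcoeff]
    exact hs
  have := UnitAddTorus.hasSum_mFourier_series_apply_of_summable hsum
    (fun i => ((0 : ι → ℝ) i : UnitAddCircle))
  have hG : G (fun i => ((0 : ι → ℝ) i : UnitAddCircle)) = ∑' n : ι → ℤ, f (castVec n) := by
    refine (hs' 0).trans ?_
    simp [hF]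
  rw [hG] at this
  refine this.congr_fun fun k => ?_
  simp [hcoeff, UnitAddTorus.mFourier]

end Poisson

/-! ### Lattice points and the functional equation of theta -/

section Lattice

variable {d : ℕ} {A : Matrix (Fin d) (Fin d) ℝ}

/-- The point `A v` of Euclidean space. -/
def latticeMap (A : Matrix (Fin d) (Fin d) ℝ) (v : Fin d → ℝ) : EuclideanSpace ℝ (Fin d) :=
  WithLp.toLp 2 (A.mulVec v)

/-- The point `A n` of the lattice `A ℤ^d`. -/
def latticePoint (A : Matrix (Fin d) (Fin d) ℝ) (n : Fin d → ℤ) : EuclideanSpace ℝ (Fin d) :=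
  latticeMap A (castVec n)

lemma latticeMap_add (v w : Fin d → ℝ) :
    latticeMap A (v + w) = latticeMap A v + latticeMap A w := by
  simp [latticeMap, Matrix.mulVec_add]

lemma continuous_latticeMap : Continuous (latticeMap A) := by
  unfold latticeMap
  exact (PiLp.continuous_toLp 2 _).comp (Continuous.matrix_mulVec continuous_const continuous_id)

lemma exists_norm_latticeMap_le (A : Matrix (Fin d) (Fin d) ℝ) (R : ℝ) :
    ∃ C : ℝ, ∀ v, ‖v‖ ≤ R → ‖latticeMap A v‖ ≤ C := by
  obtain ⟨C, hC⟩ := (isCompact_closedBall (0 : Fin d → ℝ) R).exists_bound_of_continuousOn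
    (continuous_latticeMap (A := A)).continuousOn
  exact ⟨C, fun v hv => hC v (by simpa using hv)⟩

lemma latticeMap_injective (hA : A.det ≠ 0) : Function.Injective (latticeMap A) :=
  (WithLp.toLp_injective 2).comp
    (Matrix.mulVec_injective_iff_isUnit.2 ((Matrix.isUnit_iff_isUnit_det A).2 (isUnit_iff_ne_zero.2 hA)))

lemma castVec_injective {ι : Type*} : Function.Injective (castVec (ι := ι)) :=
  fun _ _ h => funext fun i => Int.cast_injective (α := ℝ) (congrFun h i)

lemma latticePoint_injective (hA : A.det ≠ 0) : Function.Injective (latticePoint A) :=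
  (latticeMap_injective hA).comp castVec_injective

lemma latticePoint_neg (n : Fin d → ℤ) : latticePoint A (-n) = -latticePoint A n := by
  have : castVec (-n) = -castVec n := by ext i; simp [castVec]
  simp [latticePoint, latticeMap, this, Matrix.mulVec_neg]

lemma inner_latticePoint_reciprocal (hA : A.det ≠ 0) (k : Fin d → ℤ) (v : Fin d → ℝ) :
    inner ℝ (latticePoint (reciprocal A) k) (latticeMap A v) = ∑ i, (k i : ℝ) * v i := by
  have h : IsUnit A.det := isUnit_iff_ne_zero.2 hA
  have : inner ℝ (latticePoint (reciprocal A) k) (latticeMap A v) =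
      (castVec k) ⬝ᵥ v := by
    rw [latticePoint, latticeMap, latticeMap, EuclideanSpace.inner_toLp_toLp, reciprocal,
      Matrix.mulVec_transpose, star_trivial, dotProduct_comm, ← Matrix.dotProduct_mulVec,
      Matrix.mulVec_mulVec, Matrix.nonsing_inv_mul A h, Matrix.one_mulVec]
  rw [this]
  rfl

lemma det_reciprocal_ne_zero (hA : A.det ≠ 0) : (reciprocal A).det ≠ 0 := by
  rw [reciprocal, Matrix.det_transpose, Matrix.det_nonsing_inv, Ring.inverse_eq_inv']
  exact inv_ne_zero hA

lemma summable_norm_sub_latticePoint_rpow (hA : A.det ≠ 0) {r : ℝ} (hr : r < -d)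
    (x : EuclideanSpace ℝ (Fin d)) : Summable fun n => ‖x - latticePoint A n‖ ^ r := by
  have hu : IsUnit A.det := isUnit_iff_ne_zero.2 hA
  let T : (Fin d → ℝ) ≃ₗ[ℝ] EuclideanSpace ℝ (Fin d) :=
    (Matrix.toLinearEquiv' A (A.invertibleOfIsUnitDet hu)).trans (WithLp.linearEquiv 2 ℝ _).symm
  -- `A ℤ^d` is the `ℤ`-span of the columns of `A`, which makes the convergence theorem for
  -- `ℤ`-lattices applicable.
  let b := (Pi.basisFun ℝ (Fin d)).map T
  let bZ := b.restrictScalars ℤ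
  have hrank : Module.finrank ℤ (Submodule.span ℤ (Set.range b)) = d := by
    rw [Module.finrank_eq_card_basis bZ, Fintype.card_fin]
  have h := ZLattice.summable_norm_sub_rpow (Submodule.span ℤ (Set.range b)) r
    (by rwa [hrank]) x
  rw [← bZ.equivFun.symm.toEquiv.summable_iff] at h
  refine h.congr fun n => ?_
  have : ((bZ.equivFun.symm n : Submodule.span ℤ (Set.range b)) : EuclideanSpace ℝ (Fin d)) =
      latticePoint A n := by
    rw [Module.Basis.equivFun_symm_apply]
    have h1 : latticePoint A n = T (castVec n) := rfl
    rw [h1, ← (Pi.basisFun ℝ (Fin d)).sum_repr (castVec n), map_sum]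
    simp only [bZ, b, castVec, Module.Basis.restrictScalars_apply, Module.Basis.map_apply,
      Pi.basisFun_repr, map_zsmul, Submodule.coe_sum, Submodule.coe_smul, Int.cast_smul_eq_zsmul]
  simp only [Function.comp_apply, LinearEquiv.coe_toEquiv, this]
  rw [norm_sub_rev]

lemma summable_exp_neg_norm_sub_latticePoint (hA : A.det ≠ 0) (x : EuclideanSpace ℝ (Fin d))
    {t : ℝ} (ht : 0 < t) :
    Summable fun n => Real.exp (-Real.pi * ‖x - latticePoint A n‖ ^ 2 * t) := by
  -- The exponent is below `-d`, for convergence, and even, so that `exp (-u) ≤ (d+1)! / u^(d+1)`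
  -- with `u = π t |x - An|²` gives the comparison.
  have hs := summable_norm_sub_latticePoint_rpow hA (r := -((2 * (d + 1) : ℕ) : ℝ))
    (by push_cast; linarith) x
  refine Summable.of_norm_bounded_eventually
    (hs.mul_left (((d + 1).factorial : ℝ) / (Real.pi * t) ^ (d + 1))) ?_
  -- The comparison fails where `An = x`: there the negative power takes the default value `0` while
  -- the exponential is `1`.
  have hfin : {n | latticePoint A n = x}.Finite :=
    (Set.finite_singleton x).preimage (latticePoint_injective hA).injOn
  refine hfin.subset fun n hn => ?_
  by_contra hne
  refine hn ?_
  have hpos : 0 < ‖x - latticePoint A n‖ := norm_pos_iff.2 (sub_ne_zero.2 fun h => hne h.symm)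
  rw [Set.mem_ofPred_eq]
  set p := ‖x - latticePoint A n‖
  have h0 : 0 < Real.pi * t * p ^ 2 := by positivity
  have h1 := Real.pow_div_factorial_le_exp _ h0.le (d + 1)
  rw [Real.norm_eq_abs, Real.abs_exp, show -Real.pi * p ^ 2 * t = -(Real.pi * t * p ^ 2) by ring,
    Real.exp_neg, Real.rpow_neg hpos.le, Real.rpow_natCast]
  calc (Real.exp (Real.pi * t * p ^ 2))⁻¹
      ≤ ((Real.pi * t * p ^ 2) ^ (d + 1) / ((d + 1).factorial : ℝ))⁻¹ := by gcongr
    _ = _ := by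
      rw [inv_div, mul_pow, ← pow_mul]
      field_simp

/-- The phase `exp (-2πi y·An)` of a lattice point. -/
noncomputable def phase (A : Matrix (Fin d) (Fin d) ℝ) (y : EuclideanSpace ℝ (Fin d))
    (n : Fin d → ℤ) : ℂ :=
  Complex.exp (-2 * Real.pi * Complex.I * (inner ℝ y (latticePoint A n) : ℝ))

lemma norm_phase (y : EuclideanSpace ℝ (Fin d)) (n : Fin d → ℤ) : ‖phase A y n‖ = 1 := by
  rw [phase, Complex.norm_exp]
  simp

/-- The theta function of the lattice `A ℤ^d` with characteristics `x`, `y`. -/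
noncomputable def theta (A : Matrix (Fin d) (Fin d) ℝ) (x y : EuclideanSpace ℝ (Fin d))
    (t : ℝ) : ℂ :=
  ∑' n, phase A y n * Real.exp (-Real.pi * ‖x - latticePoint A n‖ ^ 2 * t)

lemma summable_theta (hA : A.det ≠ 0) (x y : EuclideanSpace ℝ (Fin d)) {t : ℝ} (ht : 0 < t) :
    Summable fun n => phase A y n * (Real.exp (-Real.pi * ‖x - latticePoint A n‖ ^ 2 * t) : ℂ) := by
  refine Summable.of_norm_bounded (summable_exp_neg_norm_sub_latticePoint hA x ht) fun n => ?_
  rw [norm_mul, norm_phase, one_mul, Complex.norm_real, Real.norm_eq_abs, Real.abs_exp]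

/-- The summand of the theta function, as a function of a continuous variable. -/
noncomputable def gaussian (x y : EuclideanSpace ℝ (Fin d)) (t : ℝ)
    (w : EuclideanSpace ℝ (Fin d)) : ℂ :=
  Complex.exp (-2 * Real.pi * Complex.I * (inner ℝ y w : ℝ)) *
    Real.exp (-Real.pi * ‖x - w‖ ^ 2 * t)

lemma continuous_gaussian (x y : EuclideanSpace ℝ (Fin d)) (t : ℝ) :
    Continuous (gaussian x y t) := by
  unfold gaussian
  fun_prop

lemma norm_gaussian (x y : EuclideanSpace ℝ (Fin d)) (t : ℝ) (w : EuclideanSpace ℝ (Fin d)) :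
    ‖gaussian x y t w‖ = Real.exp (-Real.pi * ‖x - w‖ ^ 2 * t) := by
  rw [gaussian, norm_mul, Complex.norm_exp, Complex.norm_real, Real.norm_eq_abs, Real.abs_exp]
  simp

/-- Centring at `x` leaves a pure Gaussian times a linear character, whose integral is known. -/
lemma gaussian_add (x y : EuclideanSpace ℝ (Fin d)) (t : ℝ) (u : EuclideanSpace ℝ (Fin d)) :
    gaussian x y t (u + x) = Complex.exp (-2 * Real.pi * Complex.I * (inner ℝ y x : ℝ)) *
      Complex.exp (-(Real.pi * t : ℝ) * (‖u‖ : ℂ) ^ 2 +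
        (-2 * Real.pi * Complex.I) * (inner ℝ y u : ℝ)) := by
  rw [gaussian, Complex.ofReal_exp, ← Complex.exp_add, ← Complex.exp_add, inner_add_right,
    sub_add_cancel_right, norm_neg]
  congr 1
  push_cast
  ring

lemma integrable_gaussian (x y : EuclideanSpace ℝ (Fin d)) {t : ℝ} (ht : 0 < t) :
    Integrable (gaussian x y t) := by
  have hb : 0 < (((Real.pi * t : ℝ)) : ℂ).re := by
    rw [Complex.ofReal_re]; positivity
  have h : Integrable fun u => gaussian x y t (u + x) := by
    simp_rw [gaussian_add]
    exact (GaussianFourier.integrable_cexp_neg_mul_sq_norm_add hb _ y).const_mul _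
  simpa using h.comp_add_right (-x)

lemma integral_gaussian (x y : EuclideanSpace ℝ (Fin d)) {t : ℝ} (ht : 0 < t) :
    ∫ w, gaussian x y (1 / t) w = (t : ℂ) ^ ((d : ℂ) / 2) *
      (Complex.exp (-2 * Real.pi * Complex.I * (inner ℝ y x : ℝ)) *
        Real.exp (-Real.pi * ‖y‖ ^ 2 * t)) := by
  rw [← integral_add_right_eq_self _ x]
  simp_rw [gaussian_add]
  have hb : 0 < (((Real.pi * (1 / t) : ℝ)) : ℂ).re := by
    rw [Complex.ofReal_re]; positivity
  have hpi : (Real.pi : ℂ) ≠ 0 := Complex.ofReal_ne_zero.2 Real.pi_ne_zero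
  have htc : (t : ℂ) ≠ 0 := Complex.ofReal_ne_zero.2 ht.ne'
  rw [integral_const_mul, GaussianFourier.integral_cexp_neg_mul_sq_norm_add hb,
    finrank_euclideanSpace_fin]
  have h1 : (Real.pi : ℂ) / ((Real.pi * (1 / t) : ℝ) : ℂ) = t := by
    push_cast
    field_simp
  have h2 : (-2 * Real.pi * Complex.I) ^ 2 * (‖y‖ : ℂ) ^ 2 / (4 * ((Real.pi * (1 / t) : ℝ) : ℂ)) =
      ((-Real.pi * ‖y‖ ^ 2 * t : ℝ) : ℂ) := by
    push_cast
    field_simp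
    rw [Complex.I_sq]
    ring
  rw [h1, h2, Complex.ofReal_exp]
  ring

lemma integrable_comp_latticeMap (hA : A.det ≠ 0) {g : EuclideanSpace ℝ (Fin d) → ℂ}
    (hg : Continuous g) (hgi : Integrable g) : Integrable fun v => g (latticeMap A v) := by
  have h1 : Integrable fun w : Fin d → ℝ => g (WithLp.toLp 2 w) :=
    ((PiLp.volume_preserving_toLp (Fin d)).integrable_comp_emb
      (MeasurableEquiv.toLp 2 _).measurableEmbedding).2 hgi
  have h2 : Integrable (fun w : Fin d → ℝ => g (WithLp.toLp 2 w))
      (Measure.map (Matrix.toLin' A) volume) := by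
    rw [Real.map_matrix_volume_pi_eq_smul_volume_pi hA]
    exact h1.smul_measure ENNReal.ofReal_ne_top
  exact (integrable_map_measure (hg.comp (PiLp.continuous_toLp 2 _)).aestronglyMeasurable
    (LinearMap.continuous_of_finiteDimensional _).aemeasurable).1 h2

lemma integral_comp_latticeMap (hA : A.det ≠ 0) {g : EuclideanSpace ℝ (Fin d) → ℂ}
    (hg : Continuous g) :
    ∫ v, g (latticeMap A v) = ((cellVolume A)⁻¹ : ℝ) * ∫ w, g w := by
  have h1 : ∫ w, g w = ∫ w : Fin d → ℝ, g (WithLp.toLp 2 w) :=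
    ((PiLp.volume_preserving_toLp (Fin d)).integral_comp
      (MeasurableEquiv.toLp 2 _).measurableEmbedding g).symm
  have h2 : ∫ v, g (latticeMap A v) =
      ∫ w, g (WithLp.toLp 2 w) ∂(Measure.map (Matrix.toLin' A) volume) := by
    rw [integral_map]
    · rfl
    · exact (LinearMap.continuous_of_finiteDimensional _).aemeasurable
    · exact (hg.comp (PiLp.continuous_toLp 2 _)).aestronglyMeasurable
  rw [h2, Real.map_matrix_volume_pi_eq_smul_volume_pi hA, integral_smul_measure, h1,
    ENNReal.toReal_ofReal (abs_nonneg _), abs_inv, cellVolume, Complex.real_smul]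

/-- Since `k·v = (A⁻ᵀk)·(Av)`, a Fourier mode only shifts `y` by a dual lattice point; this is how
the dual lattice enters. -/
lemma char_mul_gaussian_latticeMap (hA : A.det ≠ 0) (x y : EuclideanSpace ℝ (Fin d)) (t : ℝ)
    (k : Fin d → ℤ) (v : Fin d → ℝ) :
    char k v * gaussian x y t (latticeMap A v) =
      gaussian x (y + latticePoint (reciprocal A) k) t (latticeMap A v) := by
  rw [gaussian, gaussian, char, ← mul_assoc, ← Complex.exp_add, inner_add_left,
    inner_latticePoint_reciprocal hA]
  congr 2
  push_cast
  ring

/-- From `|x - An|² ≤ 2 |x - A(v + n)|² + 2C²`, a bounded shift costs a constant factor and half of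
`t`. -/
lemma exists_summable_bound_gaussian (hA : A.det ≠ 0) (x y : EuclideanSpace ℝ (Fin d)) {t : ℝ}
    (ht : 0 < t) (R : ℝ) : ∃ u : (Fin d → ℤ) → ℝ, Summable u ∧
      ∀ v, ‖v‖ ≤ R → ∀ n, ‖gaussian x y t (latticeMap A (v + castVec n))‖ ≤ u n := by
  obtain ⟨C, hC⟩ := exists_norm_latticeMap_le A R
  refine ⟨_, (summable_exp_neg_norm_sub_latticePoint hA x (half_pos ht)).mul_left
    (Real.exp (Real.pi * t * C ^ 2)), fun v hv n => ?_⟩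
  rw [norm_gaussian, ← Real.exp_add, Real.exp_le_exp, latticeMap_add]
  have h1 : ‖x - latticePoint A n‖ ≤
      ‖x - (latticeMap A v + latticeMap A (castVec n))‖ + ‖latticeMap A v‖ := by
    refine le_trans (le_of_eq ?_) (norm_add_le _ _)
    congr 1
    rw [latticePoint]
    abel
  have h2 := hC v hv
  set p := ‖x - (latticeMap A v + latticeMap A (castVec n))‖
  have hp : 0 ≤ p := norm_nonneg _
  have h3 : ‖x - latticePoint A n‖ ^ 2 ≤ 2 * p ^ 2 + 2 * C ^ 2 := by
    have : ‖x - latticePoint A n‖ ≤ p + C := h1.trans (by linarith)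
    have h4 := pow_le_pow_left₀ (norm_nonneg _) this 2
    nlinarith [sq_nonneg (p - C)]
  have hpt : 0 < Real.pi * t := by positivity
  nlinarith [mul_le_mul_of_nonneg_left h3 hpt.le]

/-- The functional equation of the theta function. -/
theorem theta_one_div (hA : A.det ≠ 0) (x y : EuclideanSpace ℝ (Fin d)) {t : ℝ} (ht : 0 < t) :
    theta A x y (1 / t) = (t : ℂ) ^ ((d : ℂ) / 2) * (((cellVolume A)⁻¹ : ℝ) *
      Complex.exp (-2 * Real.pi * Complex.I * (inner ℝ x y : ℝ)) *
      theta (reciprocal A) y (-x) t) := by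
  have ht' : 0 < 1 / t := by positivity
  -- Poisson summation produces `y + A⁻ᵀk`, whereas theta contains `y - A⁻ᵀk`; hence the index `-k`.
  have hterm : ∀ k : Fin d → ℤ,
      ∫ v, char k v * gaussian x y (1 / t) (latticeMap A v) =
        (t : ℂ) ^ ((d : ℂ) / 2) * (((cellVolume A)⁻¹ : ℝ) *
          Complex.exp (-2 * Real.pi * Complex.I * (inner ℝ x y : ℝ))) *
          (phase (reciprocal A) (-x) (-k) *
            Real.exp (-Real.pi * ‖y - latticePoint (reciprocal A) (-k)‖ ^ 2 * t)) := by
    intro k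
    simp_rw [char_mul_gaussian_latticeMap hA]
    rw [integral_comp_latticeMap hA (continuous_gaussian _ _ _), integral_gaussian _ _ ht,
      latticePoint_neg, sub_neg_eq_add, phase, latticePoint_neg, inner_neg_neg, inner_add_left,
      real_inner_comm x y, real_inner_comm x (latticePoint (reciprocal A) k)]
    push_cast
    rw [mul_add, Complex.exp_add]
    ring
  have hsum := (((summable_theta (det_reciprocal_ne_zero hA) y (-x) ht).mul_left
    ((t : ℂ) ^ ((d : ℂ) / 2) * (((cellVolume A)⁻¹ : ℝ) *
      Complex.exp (-2 * Real.pi * Complex.I * (inner ℝ x y : ℝ)))))).comp_injective neg_injective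
  have hsum' : Summable fun k => ∫ v, char k v * gaussian x y (1 / t) (latticeMap A v) :=
    hsum.congr fun k => (hterm k).symm
  have h := hasSum_integral_char_mul
    ((continuous_gaussian x y (1 / t)).comp (continuous_latticeMap (A := A)))
    (integrable_comp_latticeMap hA (continuous_gaussian _ _ _) (integrable_gaussian x y ht'))
    (exists_summable_bound_gaussian hA x y ht') hsum'
  rw [show theta A x y (1 / t) =
    ∑' n, gaussian x y (1 / t) (latticeMap A (castVec n)) from rfl]
  rw [← mul_assoc, theta, ← tsum_mul_left]
  refine h.tsum_eq.symm.trans ?_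
  rw [← (Equiv.neg (Fin d → ℤ)).tsum_eq]
  refine tsum_congr fun k => ?_
  have := hterm (-k)
  simp only [Function.comp_apply, Equiv.neg_apply]
  rw [this, neg_neg]

end Lattice

/-! ### Decay of exponential series -/

section Exponential

variable {ι : Type*} {a : ι → ℂ} {q : ι → ℝ}

lemma norm_mul_exp_le (ha : ∀ i, ‖a i‖ ≤ 1) (i : ι) (t : ℝ) :
    ‖a i * (Real.exp (-Real.pi * q i * t) : ℂ)‖ ≤ Real.exp (-Real.pi * q i * t) := by
  rw [norm_mul, Complex.norm_real, Real.norm_eq_abs, Real.abs_exp]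
  exact mul_le_of_le_one_left (Real.exp_pos _).le (ha i)

lemma continuousOn_tsum_mul_exp (ha : ∀ i, ‖a i‖ ≤ 1) (hq : ∀ i, 0 ≤ q i)
    (hs : ∀ t : ℝ, 0 < t → Summable fun i => Real.exp (-Real.pi * q i * t)) :
    ContinuousOn (fun t : ℝ => ∑' i, a i * (Real.exp (-Real.pi * q i * t) : ℂ)) (Ioi 0) := by
  intro t ht
  have ht' : (0 : ℝ) < t := ht
  refine ContinuousAt.continuousWithinAt ?_
  have : ContinuousOn (fun t : ℝ => ∑' i, a i * (Real.exp (-Real.pi * q i * t) : ℂ))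
      (Ioi (t / 2)) := by
    refine continuousOn_tsum (fun i => by fun_prop) (hs (t / 2) (half_pos ht')) fun i u hu => ?_
    refine (norm_mul_exp_le ha i u).trans (Real.exp_le_exp.2 ?_)
    have h1 : t / 2 < u := hu
    have h2 : 0 ≤ Real.pi * q i := mul_nonneg Real.pi_pos.le (hq i)
    nlinarith [mul_le_mul_of_nonneg_left h1.le h2]
  exact this.continuousAt (Ioi_mem_nhds (half_lt_self ht'))

/-- Summability leaves only finitely many exponents below `1`, so the nonzero ones have a positive
minimum. This spectral gap gives the decay of theta minus its limit. -/
lemma exists_pos_le_of_summable_exp (hq : ∀ i, 0 ≤ q i)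
    (hs : Summable fun i => Real.exp (-Real.pi * q i * 1)) :
    ∃ δ > 0, ∀ i, q i = 0 ∨ δ ≤ q i := by
  have hfin : {i | q i < 1}.Finite := by
    have h := hs.tendsto_cofinite_zero.eventually
      (gt_mem_nhds (Real.exp_pos (-Real.pi * 1 * 1)))
    refine Set.Finite.subset h fun i hi => ?_
    have hi' : q i < 1 := hi
    simp only [mem_compl_iff]
    intro h'
    have h'' : Real.exp (-Real.pi * q i * 1) < Real.exp (-Real.pi * 1 * 1) := h'
    rw [Real.exp_lt_exp] at h''
    nlinarith [Real.pi_pos]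
  by_cases hne : {i | q i < 1 ∧ q i ≠ 0}.Nonempty
  · obtain ⟨j, hj, hmin⟩ := Set.exists_min_image {i | q i < 1 ∧ q i ≠ 0} q
      (hfin.subset fun i hi => hi.1) hne
    refine ⟨q j, lt_of_le_of_ne (hq j) (Ne.symm hj.2), fun i => ?_⟩
    by_cases h0 : q i = 0
    · exact Or.inl h0
    · by_cases h1 : q i < 1
      · exact Or.inr (hmin i ⟨h1, h0⟩)
      · exact Or.inr (hj.1.le.trans (not_lt.1 h1))
  · refine ⟨1, one_pos, fun i => ?_⟩
    by_contra! h
    exact hne ⟨i, h.2, h.1⟩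

open Classical in
/-- The sum of the coefficients with exponent `0`. -/
noncomputable def constTerm (a : ι → ℂ) (q : ι → ℝ) : ℂ :=
  ∑' i, if q i = 0 then a i else 0

lemma constTerm_eq_zero (h : ∀ i, q i ≠ 0) : constTerm a q = 0 := by
  simp [constTerm, h]

lemma hasSum_sub_constTerm (ha : ∀ i, ‖a i‖ ≤ 1)
    (hs : ∀ t : ℝ, 0 < t → Summable fun i => Real.exp (-Real.pi * q i * t)) {t : ℝ} (ht : 0 < t) :
    HasSum (fun i => if q i = 0 then 0 else a i * (Real.exp (-Real.pi * q i * t) : ℂ))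
      (∑' i, a i * (Real.exp (-Real.pi * q i * t) : ℂ) - constTerm a q) := by
  classical
  have h1 : Summable fun i => a i * (Real.exp (-Real.pi * q i * t) : ℂ) :=
    Summable.of_norm_bounded (hs t ht) fun i => norm_mul_exp_le ha i t
  have h2 : Summable fun i => if q i = 0 then a i else 0 := by
    refine Summable.of_norm_bounded (hs t ht) fun i => ?_
    split_ifs with h
    · simpa [h] using ha i
    · simpa using (Real.exp_pos _).le
  convert! h1.hasSum.sub h2.hasSum using 1
  · ext i
    split_ifs with h <;> simp [h]

/-- For `q ≥ δ` and `t ≥ 1`, `(q - δ)(t - 1) ≥ 0` gives `qt ≥ q + δt - δ`. The remainder is thus at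
most `exp (πδ) exp (-πδt)` times the series at `t = 1`. -/
lemma isBigO_sub_constTerm (ha : ∀ i, ‖a i‖ ≤ 1) (hq : ∀ i, 0 ≤ q i)
    (hs : ∀ t : ℝ, 0 < t → Summable fun i => Real.exp (-Real.pi * q i * t)) (r : ℝ) :
    (fun t : ℝ => ∑' i, a i * (Real.exp (-Real.pi * q i * t) : ℂ) - constTerm a q)
      =O[atTop] fun t => t ^ r := by
  obtain ⟨δ, hδ, hδq⟩ := exists_pos_le_of_summable_exp hq (hs 1 one_pos)
  refine IsBigO.trans ?_ (isLittleO_exp_neg_mul_rpow_atTop (mul_pos Real.pi_pos hδ) r).isBigO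
  refine IsBigO.of_bound
    (Real.exp (Real.pi * δ) * ∑' i, Real.exp (-Real.pi * q i * 1)) ?_
  filter_upwards [eventually_ge_atTop 1] with t ht
  rw [← (hasSum_sub_constTerm ha hs (one_pos.trans_le ht)).tsum_eq, Real.norm_eq_abs,
    Real.abs_exp, mul_right_comm, mul_comm, ← Real.exp_add]
  refine tsum_of_norm_bounded ((hs 1 one_pos).hasSum.mul_right _) fun i => ?_
  rcases hδq i with h | h
  · simp only [h, if_true, norm_zero]
    positivity
  · rw [if_neg (hδ.trans_le h).ne', ← Real.exp_add]
    refine (norm_mul_exp_le ha i t).trans (Real.exp_le_exp.2 ?_)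
    nlinarith [Real.pi_pos, mul_nonneg (sub_nonneg.2 h) (sub_nonneg.2 ht)]

end Exponential

/-! ### The theta pair and its Mellin transform -/

section Pair

variable {d : ℕ} {A : Matrix (Fin d) (Fin d) ℝ}

/-- The limit of the theta function at infinity. -/
noncomputable def thetaConst (A : Matrix (Fin d) (Fin d) ℝ) (x y : EuclideanSpace ℝ (Fin d)) : ℂ :=
  constTerm (phase A y) fun n => ‖x - latticePoint A n‖ ^ 2

/-- These limits are the coefficients of the polar terms of the Mellin transform; lattice membership
enters the theorem only here. -/
lemma thetaConst_eq_zero {x y : EuclideanSpace ℝ (Fin d)} (hx : x ∉ lattice A) :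
    thetaConst A x y = 0 := by
  refine constTerm_eq_zero fun n h => hx ⟨n, ?_⟩
  exact (sub_eq_zero.1 (norm_eq_zero.1 (pow_eq_zero_iff two_ne_zero |>.1 h))).symm

lemma continuousOn_theta (hA : A.det ≠ 0) (x y : EuclideanSpace ℝ (Fin d)) :
    ContinuousOn (theta A x y) (Ioi 0) :=
  continuousOn_tsum_mul_exp (fun n => (norm_phase y n).le) (fun _ => sq_nonneg _)
    fun _ ht => summable_exp_neg_norm_sub_latticePoint hA x ht

lemma isBigO_theta_sub (hA : A.det ≠ 0) (x y : EuclideanSpace ℝ (Fin d)) (r : ℝ) :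
    (fun t => theta A x y t - thetaConst A x y) =O[atTop] fun t => t ^ r :=
  isBigO_sub_constTerm (fun n => (norm_phase y n).le) (fun _ => sq_nonneg _)
    (fun _ ht => summable_exp_neg_norm_sub_latticePoint hA x ht) r

/-- The factor `V⁻¹ exp (-2πi x·y)` in the functional equation of the theta function. -/
noncomputable def dualFactor (A : Matrix (Fin d) (Fin d) ℝ) (x y : EuclideanSpace ℝ (Fin d)) : ℂ :=
  ((cellVolume A)⁻¹ : ℝ) * Complex.exp (-2 * Real.pi * Complex.I * (inner ℝ x y : ℝ))

lemma dualFactor_ne_zero (hA : A.det ≠ 0) (x y : EuclideanSpace ℝ (Fin d)) :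
    dualFactor A x y ≠ 0 :=
  mul_ne_zero (Complex.ofReal_ne_zero.2 (inv_ne_zero (abs_ne_zero.2 hA))) (Complex.exp_ne_zero _)

/-- The theta functions of a lattice and of its reciprocal lattice, related by the theta
functional equation. -/
noncomputable def thetaPair (hd : 0 < d) (hA : A.det ≠ 0) (x y : EuclideanSpace ℝ (Fin d)) :
    WeakFEPair ℂ where
  f := theta A x y
  -- With the constant absorbed into `g`, the pair has `ε = 1`. The price is the scalar `c` in later
  -- lemmas: `1` for the lattice, `dualFactor A x y` for its reciprocal.
  g := fun t => dualFactor A x y * theta (reciprocal A) y (-x) t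
  k := d / 2
  ε := 1
  f₀ := thetaConst A x y
  g₀ := dualFactor A x y * thetaConst (reciprocal A) y (-x)
  hf_int := (continuousOn_theta hA x y).locallyIntegrableOn measurableSet_Ioi
  hg_int := (continuousOn_const.mul (continuousOn_theta (det_reciprocal_ne_zero hA) y
    (-x))).locallyIntegrableOn measurableSet_Ioi
  hk := by positivity
  hε := one_ne_zero
  h_feq := fun t ht => by
    rw [theta_one_div hA x y ht, smul_eq_mul, one_mul, Complex.ofReal_cpow (le_of_lt ht)]
    simp [dualFactor]
  hf_top := isBigO_theta_sub hA x y
  hg_top := fun r => by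
    simp_rw [← mul_sub]
    exact (isBigO_theta_sub (det_reciprocal_ne_zero hA) y (-x) r).const_mul_left _

/-- The Mellin transform of a multiple of the theta function is a lattice sum. -/
lemma hasSum_mellin_theta (hd : 0 < d) (hA : A.det ≠ 0) (x y : EuclideanSpace ℝ (Fin d)) (c : ℂ)
    {ν : ℂ} (hν : (d : ℝ) < ν.re) :
    HasSum (fun z : {z : EuclideanSpace ℝ (Fin d) // z ∈ lattice A ∧ z ≠ x} =>
      c * (Real.pi ^ (-(ν / 2)) * Complex.Gamma (ν / 2)) * latticeTerm ν x y z)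
      (mellin (fun t => c * theta A x y t - c * thetaConst A x y) (ν / 2)) := by
  have hd' : (0 : ℝ) < d := by exact_mod_cast hd
  have hν0 : ν ≠ 0 := fun h => by rw [h, Complex.zero_re] at hν; linarith
  have hre : (ν / 2).re = ν.re / 2 := by simp
  have hre0 : 0 < (ν / 2).re := by rw [hre]; linarith
  have hpow : ∀ p : ℝ, 0 ≤ p → (p ^ 2) ^ (ν.re / 2) = p ^ ν.re := fun p hp => by
    rw [← Real.rpow_natCast, ← Real.rpow_mul hp]
    congr 1
    push_cast
    ring
  have hcpow : ∀ p : ℝ, 0 ≤ p → ((p ^ 2 : ℝ) : ℂ) ^ (ν / 2) = (p : ℂ) ^ ν := fun p hp => by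
    rw [Complex.ofReal_pow, ← Complex.cpow_nat_mul']
    · push_cast
      ring_nf
    all_goals
      rw [Complex.arg_ofReal_of_nonneg hp]
      simp [Real.pi_pos, Real.pi_pos.le]
  have h := hasSum_mellin_pi_mul₀ (a := fun n => c * phase A y n)
    (p := fun n => ‖x - latticePoint A n‖ ^ 2)
    (F := fun t => c * theta A x y t - c * thetaConst A x y) (s := ν / 2)
    (fun _ => sq_nonneg _) hre0 (fun t ht => ?_) ?_
  · simp_rw [hcpow _ (norm_nonneg _)] at h
    -- The Mellin series runs over all `n`, the zeta sum over lattice points other than `x`. The map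
    -- `e` misses only `n` with `An = x`, whose term is zero because `0 ^ ν = 0` and division by
    -- zero gives `0`.
    let e : {z : EuclideanSpace ℝ (Fin d) // z ∈ lattice A ∧ z ≠ x} → (Fin d → ℤ) :=
      fun z => z.2.1.choose
    have he : ∀ z, latticePoint A (e z) = z := fun z => z.2.1.choose_spec
    have hinj : Function.Injective e := fun z w hzw => Subtype.ext (by rw [← he, ← he w, hzw])
    rw [← hinj.hasSum_iff] at h
    · refine h.congr_fun fun z => ?_
      simp only [Function.comp_apply, phase, latticeTerm, he]
      ring
    · intro n hn
      have : latticePoint A n = x := by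
        by_contra hne
        exact hn ⟨⟨latticePoint A n, ⟨n, rfl⟩, hne⟩,
          latticePoint_injective hA (he _)⟩
      simp [this, Complex.zero_cpow hν0]
  · have := (hasSum_sub_constTerm (fun n => (norm_phase (A := A) y n).le)
      (fun _ ht => summable_exp_neg_norm_sub_latticePoint hA x ht) ht).mul_left c
    rw [mul_sub] at this
    refine this.congr_fun fun n => ?_
    split_ifs <;> ring
  · have hs := (summable_norm_sub_latticePoint_rpow hA (neg_lt_neg hν) x).mul_left ‖c‖
    refine hs.congr fun n => ?_
    rw [norm_mul, norm_phase, mul_one, hre, hpow _ (norm_nonneg _),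
      Real.rpow_neg (norm_nonneg _), div_eq_mul_inv]

end Pair

/-! ### Removing the poles with reciprocal Gamma factors -/

section Completion

/-- The quotient of `P.Λ` by the Gamma function, with the singularity at `0` removed. -/
noncomputable def gammaQuotient (P : WeakFEPair ℂ) (s : ℂ) : ℂ :=
  (Complex.Gamma s)⁻¹ * (P.Λ₀ s - P.ε * P.g₀ / (P.k - s)) - (Complex.Gamma (s + 1))⁻¹ * P.f₀

/-- The quotient of `P.Λ` by the Gamma functions at `s` and at `k - s`, with all singularities
removed. -/
noncomputable def doubleGammaQuotient (P : WeakFEPair ℂ) (s : ℂ) : ℂ :=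
  (Complex.Gamma s)⁻¹ * (Complex.Gamma (P.k - s))⁻¹ * P.Λ₀ s -
    (Complex.Gamma (P.k - s))⁻¹ * (Complex.Gamma (s + 1))⁻¹ * P.f₀ -
    (Complex.Gamma s)⁻¹ * (Complex.Gamma (P.k - s + 1))⁻¹ * (P.ε * P.g₀)

lemma differentiable_inv_Gamma_comp {h : ℂ → ℂ} (hh : Differentiable ℂ h) :
    Differentiable ℂ fun s => (Complex.Gamma (h s))⁻¹ :=
  Complex.differentiable_one_div_Gamma.comp hh

/-- The identity `1/Γ(s) = s/Γ(s+1)` cancels the polar term `f₀/s`. -/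
lemma gammaQuotient_eq (P : WeakFEPair ℂ) {s : ℂ} (hs : s ≠ 0) :
    gammaQuotient P s = (Complex.Gamma s)⁻¹ * P.Λ s := by
  rw [gammaQuotient, P.Λ₀_eq, Complex.one_div_Gamma_eq_self_mul_one_div_Gamma_add_one s]
  simp only [smul_eq_mul]
  field_simp
  ring

/-- The same cancellation at `k - s`; if `g₀ = 0`, there is no pole to cancel and `s = k` is
allowed. -/
lemma inv_Gamma_mul_gammaQuotient (P : WeakFEPair ℂ) {s : ℂ} (hs : s ≠ P.k ∨ P.g₀ = 0) :
    (Complex.Gamma (P.k - s))⁻¹ * gammaQuotient P s = doubleGammaQuotient P s := by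
  rcases hs with hs | hs
  · have h : (P.k : ℂ) - s ≠ 0 := sub_ne_zero.2 hs.symm
    have hG : (Complex.Gamma (P.k - s + 1))⁻¹ = (Complex.Gamma (P.k - s))⁻¹ / (P.k - s) := by
      rw [Complex.one_div_Gamma_eq_self_mul_one_div_Gamma_add_one (P.k - s)]
      field_simp
    rw [gammaQuotient, doubleGammaQuotient, hG]
    ring
  · rw [gammaQuotient, doubleGammaQuotient, hs]
    ring

lemma differentiable_doubleGammaQuotient (P : WeakFEPair ℂ) :
    Differentiable ℂ (doubleGammaQuotient P) := by
  have h1 := Complex.differentiable_one_div_Gamma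
  have h2 : Differentiable ℂ fun s : ℂ => (Complex.Gamma (P.k - s))⁻¹ :=
    differentiable_inv_Gamma_comp (by fun_prop)
  have h3 : Differentiable ℂ fun s : ℂ => (Complex.Gamma (s + 1))⁻¹ :=
    differentiable_inv_Gamma_comp (by fun_prop)
  have h4 : Differentiable ℂ fun s : ℂ => (Complex.Gamma (P.k - s + 1))⁻¹ :=
    differentiable_inv_Gamma_comp (by fun_prop)
  exact (((h1.mul h2).mul P.differentiable_Λ₀).sub ((h2.mul h3).mul_const _)).sub
    ((h1.mul h4).mul_const _)

/-- Passing to `P.symm` and `k - s` swaps the Gamma factors and the constants `f₀`, `g₀`, while `Λ₀`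
obeys its own functional equation. -/
lemma doubleGammaQuotient_symm (P : WeakFEPair ℂ) (hε : P.ε = 1) (s : ℂ) :
    doubleGammaQuotient P.symm (P.k - s) = doubleGammaQuotient P s := by
  have h := P.functional_equation₀ (P.k - s)
  rw [sub_sub_cancel, hε, one_smul] at h
  simp only [doubleGammaQuotient, WeakFEPair.symm_k, WeakFEPair.symm_ε, WeakFEPair.symm_f₀,
    WeakFEPair.symm_g₀, hε, sub_sub_cancel, h, inv_one]
  ring

lemma meromorphicAt_gammaQuotient (P : WeakFEPair ℂ) (s : ℂ) :
    MeromorphicAt (gammaQuotient P) s := by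
  have h1 := (Complex.differentiable_one_div_Gamma.analyticAt s).meromorphicAt
  have h2 := (P.differentiable_Λ₀.analyticAt s).meromorphicAt
  have h3 : Differentiable ℂ fun s : ℂ => (Complex.Gamma (s + 1))⁻¹ :=
    differentiable_inv_Gamma_comp (by fun_prop)
  have h4 : Differentiable ℂ fun s : ℂ => (P.k : ℂ) - s := by fun_prop
  exact (h1.mul (h2.sub ((MeromorphicAt.const _ s).div (h4.analyticAt s).meromorphicAt))).sub
    ((h3.analyticAt s).meromorphicAt.mul (MeromorphicAt.const _ s))

lemma analyticAt_gammaQuotient (P : WeakFEPair ℂ) {s : ℂ} (hs : s ≠ P.k ∨ P.g₀ = 0) :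
    AnalyticAt ℂ (gammaQuotient P) s := by
  have h1 := Complex.differentiable_one_div_Gamma.analyticAt s
  have h2 := P.differentiable_Λ₀.analyticAt s
  have h3 : Differentiable ℂ fun s : ℂ => (Complex.Gamma (s + 1))⁻¹ :=
    differentiable_inv_Gamma_comp (by fun_prop)
  have h4 : Differentiable ℂ fun s : ℂ => (P.k : ℂ) - s := by fun_prop
  have h5 : AnalyticAt ℂ (fun s => P.ε * P.g₀ / (P.k - s)) s := by
    rcases hs with hs | hs
    · exact analyticAt_const.div (h4.analyticAt s) (sub_ne_zero.2 hs.symm)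
    · simp only [hs, mul_zero, zero_div]
      exact analyticAt_const
  exact (h1.mul (h2.sub h5)).sub ((h3.analyticAt s).mul analyticAt_const)

end Completion

/-! ### The continuation of the lattice sum -/

section Continuation

/-- The explicit continuation may have the wrong default value at its pole, so its normal form is
taken; this leaves it unchanged wherever it is analytic. -/
lemma toMeromorphicNFOn_eventuallyEq_of_analyticAt {f : ℂ → ℂ} (hf : MeromorphicOn f univ) {s : ℂ}
    (hs : AnalyticAt ℂ f s) : toMeromorphicNFOn f univ =ᶠ[𝓝 s] f := by
  have h := toMeromorphicNFOn_eq_toMeromorphicNFAt_on_nhds hf (mem_univ s)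
  rwa [toMeromorphicNFAt_eq_self.2 hs.meromorphicNFAt] at h

variable {d : ℕ} {A : Matrix (Fin d) (Fin d) ℝ}

lemma IsContinuation.epsteinZeta_eq {L : Set (EuclideanSpace ℝ (Fin d))}
    {x y : EuclideanSpace ℝ (Fin d)} {f : ℂ → ℂ} (hf : IsContinuation L x y f) :
    (fun ν => epsteinZeta L ν x y) = f := by
  have h : ∃ f : ℂ → ℂ, IsContinuation L x y f := ⟨f, hf⟩
  have h' : (fun ν => epsteinZeta L ν x y) = h.choose := by
    funext ν
    rw [epsteinZeta, dif_pos h]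
  rw [h']
  exact h.choose_spec.unique hf

variable {P : WeakFEPair ℂ} {x y : EuclideanSpace ℝ (Fin d)} {c : ℂ}

/-- The lattice sum, continued to `ℂ` by means of the Mellin transform of the theta function. -/
noncomputable def continuedSum (P : WeakFEPair ℂ) (c : ℂ) (ν : ℂ) : ℂ :=
  c⁻¹ * (Real.pi : ℂ) ^ (ν / 2) * gammaQuotient P (ν / 2)

lemma analyticAt_pi_cpow (ν : ℂ) : AnalyticAt ℂ (fun ν : ℂ => (Real.pi : ℂ) ^ (ν / 2)) ν := by
  have : Differentiable ℂ fun ν : ℂ => (Real.pi : ℂ) ^ (ν / 2) := fun ν =>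
    DifferentiableAt.const_cpow (by fun_prop) (Or.inl (Complex.ofReal_ne_zero.2 Real.pi_ne_zero))
  exact this.analyticAt ν

lemma analyticAt_div_two (ν : ℂ) : AnalyticAt ℂ (fun ν : ℂ => ν / 2) ν :=
  (differentiable_id.div_const 2).analyticAt ν

lemma meromorphicOn_continuedSum (P : WeakFEPair ℂ) (c : ℂ) :
    MeromorphicOn (continuedSum P c) univ := fun ν _ =>
  ((MeromorphicAt.const c⁻¹ ν).mul (analyticAt_pi_cpow ν).meromorphicAt).mul
    (MeromorphicAt.comp_analyticAt (f := gammaQuotient P) (g := fun ν : ℂ => ν / 2)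
      (meromorphicAt_gammaQuotient P (ν / 2)) (analyticAt_div_two ν))

lemma analyticAt_continuedSum (c : ℂ) {ν : ℂ} (hν : ν / 2 ≠ P.k ∨ P.g₀ = 0) :
    AnalyticAt ℂ (continuedSum P c) ν :=
  (analyticAt_const.mul (analyticAt_pi_cpow ν)).mul
    (AnalyticAt.fun_comp (analyticAt_gammaQuotient P hν) (analyticAt_div_two ν))

lemma hasSum_continuedSum (hd : 0 < d) (hA : A.det ≠ 0) (hc : c ≠ 0) (hk : P.k = d / 2)
    (hf : P.f = fun t => c * theta A x y t) (hf₀ : P.f₀ = c * thetaConst A x y) {ν : ℂ}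
    (hν : (d : ℝ) < ν.re) :
    HasSum (fun z : {z : EuclideanSpace ℝ (Fin d) // z ∈ lattice A ∧ z ≠ x} =>
      latticeTerm ν x y z) (continuedSum P c ν) := by
  have hre : (ν / 2).re = ν.re / 2 := by simp
  have hd' : (0 : ℝ) < d := by exact_mod_cast hd
  have hre0 : 0 < (ν / 2).re := by rw [hre]; linarith
  have hs0 : ν / 2 ≠ 0 := fun h => by rw [h, Complex.zero_re] at hre0; exact lt_irrefl _ hre0
  have hpi : (Real.pi : ℂ) ^ (ν / 2) ≠ 0 := by
    simp [Complex.cpow_eq_zero_iff, Real.pi_ne_zero]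
  have hG := Complex.Gamma_ne_zero_of_re_pos hre0
  have h := hasSum_mellin_theta hd hA x y c hν
  have hm : mellin (fun t => c * theta A x y t - c * thetaConst A x y) (ν / 2) = P.Λ (ν / 2) := by
    rw [← (P.hasMellin (s := ν / 2) (by rw [hk, hre]; linarith)).2, hf, hf₀]
  rw [hm] at h
  have h2 := h.mul_left (c⁻¹ * (Real.pi : ℂ) ^ (ν / 2) * (Complex.Gamma (ν / 2))⁻¹)
  rw [continuedSum, gammaQuotient_eq P hs0, ← mul_assoc]
  refine h2.congr_fun fun z => ?_
  rw [Complex.cpow_neg]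
  field_simp

lemma div_two_ne_of_ne (hk : P.k = d / 2) {ν : ℂ} (hν : ν ≠ d ∨ P.g₀ = 0) :
    ν / 2 ≠ P.k ∨ P.g₀ = 0 := by
  refine hν.imp_left fun h h' => h ?_
  rw [hk] at h'
  push_cast at h'
  linear_combination 2 * h'

lemma isContinuation_continuedSum (hd : 0 < d) (hA : A.det ≠ 0) (hc : c ≠ 0) (hk : P.k = d / 2)
    (hf : P.f = fun t => c * theta A x y t) (hf₀ : P.f₀ = c * thetaConst A x y) :
    IsContinuation (lattice A) x y (toMeromorphicNFOn (continuedSum P c) univ) := by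
  refine ⟨meromorphicNFOn_toMeromorphicNFOn _ _, fun ν hν => ?_⟩
  have hne : ν ≠ d := fun h => by rw [h, Complex.natCast_re] at hν; exact lt_irrefl _ hν
  rw [(toMeromorphicNFOn_eventuallyEq_of_analyticAt (meromorphicOn_continuedSum P c)
    (analyticAt_continuedSum c (div_two_ne_of_ne hk (Or.inl hne)))).eq_of_nhds]
  exact hasSum_continuedSum hd hA hc hk hf hf₀ hν

lemma epsteinZeta_eventuallyEq (hd : 0 < d) (hA : A.det ≠ 0) (hc : c ≠ 0) (hk : P.k = d / 2)
    (hf : P.f = fun t => c * theta A x y t) (hf₀ : P.f₀ = c * thetaConst A x y) {ν : ℂ}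
    (hν : ν ≠ d ∨ P.g₀ = 0) :
    (fun s => epsteinZeta (lattice A) s x y) =ᶠ[𝓝 ν] continuedSum P c := by
  rw [(isContinuation_continuedSum hd hA hc hk hf hf₀).epsteinZeta_eq]
  exact toMeromorphicNFOn_eventuallyEq_of_analyticAt (meromorphicOn_continuedSum P c)
    (analyticAt_continuedSum c (div_two_ne_of_ne hk hν))

lemma analyticAt_epsteinZeta (hd : 0 < d) (hA : A.det ≠ 0) (hc : c ≠ 0) (hk : P.k = d / 2)
    (hf : P.f = fun t => c * theta A x y t) (hf₀ : P.f₀ = c * thetaConst A x y) {ν : ℂ}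
    (hν : ν ≠ d ∨ P.g₀ = 0) :
    AnalyticAt ℂ (fun s => epsteinZeta (lattice A) s x y) ν :=
  (analyticAt_continuedSum c (div_two_ne_of_ne hk hν)).congr
    (epsteinZeta_eventuallyEq hd hA hc hk hf hf₀ hν).symm

/-- The power of `π` in `completedProduct` cancels that in `continuedSum`, and its Gamma factor is
the second one in `doubleGammaQuotient`. The right side makes sense at every `ν`. -/
lemma completedProduct_eq (hd : 0 < d) (hA : A.det ≠ 0) (hc : c ≠ 0) (hk : P.k = d / 2)
    (hf : P.f = fun t => c * theta A x y t) (hf₀ : P.f₀ = c * thetaConst A x y) {ν : ℂ}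
    (hν : ν ≠ d ∨ P.g₀ = 0) :
    completedProduct A ν x y = ((cellVolume A ^ (2 / (d : ℝ)) : ℝ) : ℂ) ^ (ν / 2) *
      Complex.exp ((Real.pi : ℂ) * Complex.I * ((inner ℝ x y : ℝ) : ℂ)) * c⁻¹ *
      doubleGammaQuotient P (ν / 2) := by
  have hV : 0 ≤ cellVolume A ^ (2 / (d : ℝ)) / Real.pi :=
    div_nonneg (Real.rpow_nonneg (abs_nonneg _) _) Real.pi_pos.le
  have hpow : ((cellVolume A ^ (2 / (d : ℝ)) : ℝ) : ℂ) ^ (ν / 2) =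
      ((cellVolume A ^ (2 / (d : ℝ)) / Real.pi : ℝ) : ℂ) ^ (ν / 2) * (Real.pi : ℂ) ^ (ν / 2) := by
    rw [← Complex.mul_cpow_ofReal_nonneg hV Real.pi_pos.le, ← Complex.ofReal_mul,
      div_mul_cancel₀ _ Real.pi_ne_zero]
  have hG : ((d : ℂ) - ν) / 2 = P.k - ν / 2 := by
    rw [hk]
    push_cast
    ring
  have hz := (epsteinZeta_eventuallyEq hd hA hc hk hf hf₀ hν).eq_of_nhds
  rw [completedProduct, hz, continuedSum, hpow, hG,
    ← inv_Gamma_mul_gammaQuotient P (div_two_ne_of_ne hk hν)]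
  ring

end Continuation

/-! ### Volume factors and the main theorem -/

section Main

variable {d : ℕ} {A : Matrix (Fin d) (Fin d) ℝ}

lemma cellVolume_reciprocal (A : Matrix (Fin d) (Fin d) ℝ) :
    cellVolume (reciprocal A) = (cellVolume A)⁻¹ := by
  rw [cellVolume, reciprocal, Matrix.det_transpose, Matrix.det_nonsing_inv, Ring.inverse_eq_inv',
    abs_inv, cellVolume]

/-- In exponents of `V`: `-(d - ν)/d + 1 = ν/d`. The extra `V` on the left is the one in the inverse
of `dualFactor`. -/
lemma cpow_cellVolume_reciprocal (hd : 0 < d) (hA : A.det ≠ 0) (ν : ℂ) :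
    ((cellVolume (reciprocal A) ^ (2 / (d : ℝ)) : ℝ) : ℂ) ^ (((d : ℂ) - ν) / 2) *
      (cellVolume A : ℂ) = ((cellVolume A ^ (2 / (d : ℝ)) : ℝ) : ℂ) ^ (ν / 2) := by
  have hV : 0 < cellVolume A := abs_pos.2 hA
  have hVc : (cellVolume A : ℂ) ≠ 0 := Complex.ofReal_ne_zero.2 hV.ne'
  have hW : 0 < cellVolume A ^ (2 / (d : ℝ)) := Real.rpow_pos_of_pos hV _
  have hWc : ((cellVolume A ^ (2 / (d : ℝ)) : ℝ) : ℂ) ≠ 0 := Complex.ofReal_ne_zero.2 hW.ne'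
  have hd' : (d : ℝ) ≠ 0 := by positivity
  have hpow : ((cellVolume A ^ (2 / (d : ℝ)) : ℝ) : ℂ) ^ ((d : ℂ) / 2) = cellVolume A := by
    have : ((d : ℂ) / 2) = ((d / 2 : ℝ) : ℂ) := by push_cast; ring
    rw [this, ← Complex.ofReal_cpow hW.le, ← Real.rpow_mul hV.le]
    congr 1
    rw [div_mul_div_cancel₀ hd', div_self two_ne_zero, Real.rpow_one]
  rw [cellVolume_reciprocal, Real.inv_rpow hV.le, Complex.ofReal_inv, Complex.inv_cpow,
    ← Complex.cpow_neg, show -(((d : ℂ) - ν) / 2) = ν / 2 - (d : ℂ) / 2 by ring,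
    Complex.cpow_sub _ _ hWc, hpow, div_mul_cancel₀ _ hVc]
  rw [Complex.arg_ofReal_of_nonneg hW.le]
  exact Real.pi_ne_zero.symm

end Main

end EpsteinZeta

open EpsteinZeta

theorem mainTheorem3 (d : ℕ) (hd : 0 < d) (A : Matrix (Fin d) (Fin d) ℝ) (hA : A.det ≠ 0)
    (x y : EuclideanSpace ℝ (Fin d)) :
    -- both zeta functions are well defined
    EpsteinZeta.IsContinuation (EpsteinZeta.lattice A) x y
      (fun ν : ℂ => EpsteinZeta.epsteinZeta (EpsteinZeta.lattice A) ν x y) ∧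
    EpsteinZeta.IsContinuation (EpsteinZeta.lattice (EpsteinZeta.reciprocal A)) y (-x)
      (fun ν : ℂ => EpsteinZeta.epsteinZeta
        (EpsteinZeta.lattice (EpsteinZeta.reciprocal A)) ν y (-x)) ∧
    -- their only possible poles
    (∀ ν : ℂ, ¬ (ν = (d : ℂ) ∧ y ∈ EpsteinZeta.lattice (EpsteinZeta.reciprocal A)) →
      AnalyticAt ℂ (fun s : ℂ => EpsteinZeta.epsteinZeta (EpsteinZeta.lattice A) s x y) ν) ∧
    (∀ ν : ℂ, ¬ (ν = 0 ∧ x ∈ EpsteinZeta.lattice A) →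
      AnalyticAt ℂ (fun s : ℂ => EpsteinZeta.epsteinZeta
        (EpsteinZeta.lattice (EpsteinZeta.reciprocal A)) ((d : ℂ) - s) y (-x)) ν) ∧
    -- invariance wherever both zeta values are finite
    (∀ ν : ℂ, ¬ (ν = (d : ℂ) ∧ y ∈ EpsteinZeta.lattice (EpsteinZeta.reciprocal A)) →
      ¬ (ν = 0 ∧ x ∈ EpsteinZeta.lattice A) →
      EpsteinZeta.completedProduct A ν x y =
        EpsteinZeta.completedProduct (EpsteinZeta.reciprocal A) ((d : ℂ) - ν) y (-x)) ∧
    -- invariance for all `ν`, with the removable singularities at the poles filled in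
    (∃ F : ℂ → ℂ, Differentiable ℂ F ∧
      (∀ ν : ℂ, ¬ (ν = (d : ℂ) ∧ y ∈ EpsteinZeta.lattice (EpsteinZeta.reciprocal A)) →
        EpsteinZeta.completedProduct A ν x y = F ν) ∧
      (∀ ν : ℂ, ¬ (ν = 0 ∧ x ∈ EpsteinZeta.lattice A) →
        EpsteinZeta.completedProduct (EpsteinZeta.reciprocal A) ((d : ℂ) - ν) y (-x) = F ν)) := by
  set P := thetaPair hd hA x y
  have hA' := det_reciprocal_ne_zero hA
  have hc := dualFactor_ne_zero hA x y
  have hk : P.k = d / 2 := rfl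
  have hf : P.f = fun t => 1 * theta A x y t := by
    simp only [one_mul]
    rfl
  have hf₀ : P.f₀ = 1 * thetaConst A x y := (one_mul _).symm
  have hk' : P.symm.k = d / 2 := rfl
  have hg : P.symm.f = fun t => dualFactor A x y * theta (reciprocal A) y (-x) t := rfl
  have hg₀ : P.symm.f₀ = dualFactor A x y * thetaConst (reciprocal A) y (-x) := rfl
  have hν₁ : ∀ {ν : ℂ}, ¬ (ν = (d : ℂ) ∧ y ∈ lattice (reciprocal A)) → ν ≠ d ∨ P.g₀ = 0 := by
    intro ν h
    refine (not_and_or.1 h).imp_right fun hy => ?_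
    change dualFactor A x y * thetaConst (reciprocal A) y (-x) = 0
    rw [thetaConst_eq_zero hy, mul_zero]
  -- The dual constant of `P.symm` is `thetaConst A x y`, which vanishes off `Λ`.
  have hν₂ : ∀ {ν : ℂ}, ¬ (ν = 0 ∧ x ∈ lattice A) → (d : ℂ) - ν ≠ d ∨ P.symm.g₀ = 0 := by
    intro ν h
    exact (not_and_or.1 h).imp (fun h0 h1 => h0 (by linear_combination -h1)) thetaConst_eq_zero
  let F : ℂ → ℂ := fun ν => ((cellVolume A ^ (2 / (d : ℝ)) : ℝ) : ℂ) ^ (ν / 2) *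
      Complex.exp ((Real.pi : ℂ) * Complex.I * ((inner ℝ x y : ℝ) : ℂ)) *
      doubleGammaQuotient P (ν / 2)
  have hF : Differentiable ℂ F := by
    have hV : ((cellVolume A ^ (2 / (d : ℝ)) : ℝ) : ℂ) ≠ 0 :=
      Complex.ofReal_ne_zero.2 (Real.rpow_pos_of_pos (abs_pos.2 hA) _).ne'
    have h1 : Differentiable ℂ fun ν : ℂ =>
        ((cellVolume A ^ (2 / (d : ℝ)) : ℝ) : ℂ) ^ (ν / 2) := fun ν =>
      DifferentiableAt.const_cpow (by fun_prop) (Or.inl hV)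
    exact (h1.mul_const _).mul
      ((differentiable_doubleGammaQuotient P).comp (differentiable_id.div_const 2))
  have hF₁ : ∀ ν : ℂ, ¬ (ν = (d : ℂ) ∧ y ∈ lattice (reciprocal A)) →
      completedProduct A ν x y = F ν := by
    intro ν hν
    rw [completedProduct_eq hd hA one_ne_zero hk hf hf₀ (hν₁ hν), inv_one, mul_one]
  have hF₂ : ∀ ν : ℂ, ¬ (ν = 0 ∧ x ∈ lattice A) →
      completedProduct (reciprocal A) ((d : ℂ) - ν) y (-x) = F ν := by
    intro ν hν
    have hs : ((d : ℂ) - ν) / 2 = P.k - ν / 2 := by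
      rw [hk]
      push_cast
      ring
    rw [completedProduct_eq hd hA' hc hk' hg hg₀ (hν₂ hν)]
    simp only [F]
    rw [← cpow_cellVolume_reciprocal hd hA, hs, doubleGammaQuotient_symm P rfl, dualFactor,
      mul_inv, ← Complex.exp_neg, inner_neg_right, real_inner_comm x y]
    -- The inverse of `dualFactor` contributes `e^(2πi x·y)`, which turns the dual phase `e^(-πi
    -- x·y)` into `e^(πi x·y)`.
    have hexp : Complex.exp ((Real.pi : ℂ) * Complex.I * ((inner ℝ x y : ℝ) : ℂ)) =
        Complex.exp ((Real.pi : ℂ) * Complex.I * ((-inner ℝ x y : ℝ) : ℂ)) *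
          Complex.exp (-(-2 * Real.pi * Complex.I * ((inner ℝ x y : ℝ) : ℂ))) := by
      rw [← Complex.exp_add]
      congr 1
      push_cast
      ring
    rw [hexp]
    push_cast
    rw [inv_inv]
    ring
  have hc₁ := isContinuation_continuedSum hd hA one_ne_zero hk hf hf₀
  have hc₂ := isContinuation_continuedSum hd hA' hc hk' hg hg₀
  refine ⟨?_, ?_, fun ν hν => ?_, fun ν hν => ?_, fun ν h₁ h₂ => ?_, F, hF, hF₁, hF₂⟩
  · rwa [hc₁.epsteinZeta_eq]
  · rwa [hc₂.epsteinZeta_eq]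
  · exact analyticAt_epsteinZeta hd hA one_ne_zero hk hf hf₀ (hν₁ hν)
  · have h := analyticAt_epsteinZeta hd hA' hc hk' hg hg₀ (hν₂ hν)
    exact AnalyticAt.fun_comp (f := fun s : ℂ => (d : ℂ) - s) h
      (((differentiable_const _).sub differentiable_id).analyticAt ν)
  · rw [hF₁ ν h₁, hF₂ ν h₂]
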